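/- Let $(\Omega,\mathcal F,\mathbb Q)$ be a probability space, $m>0$ and $T>0$. A standard gamma process with growth rate $m$ is a process $\{\gamma_t\}_{t\ge 0}$ with independent increments, with $\gamma_0=0$, and such that for each $t>0$ the random variable $\gamma_t$ has density $x^{mt-1}e^{-x}/\Gamma(mt)$ on $x>0$; a standard gamma bridge over $[0,T]$ with parameter $m$ is any process $\{\gamma_{tT}\}_{0\le t\le T}$ having the law of $\{\gamma_t/\gamma_T\}_{0\le t\le T}$ for such a process $\{\gamma_t\}$. Let $\{\gamma_{tT}\}_{0\le t\le T}$ be a standard gamma bridge over $[0,T]$ with parameter $m$ on $(\Omega,\mathcal F,\mathbb Q)$, and let $X_T$ be a strictly positive random variable that is independent of the process $\{\gamma_{tT}\}_{0\le t\le T}$. Define the aggregate claims process by $\xi_t=X_T\gamma_{tT}$ for $0\le t\le T$, and let $\mathcal F_t=\sigma(\{\xi_u\}_{0\le u\le t})$. (Equalities and inequalities between random variables are understood almost surely.) Then $\{\xi_t\}_{0\le t\le T}$ has the Markov property with respect to $\{\mathcal F_t\}$: for all $0\le s\le t\le T$ and every Borel set $B\subseteq\mathbb R$, $$\mathbb Q[\xi_t\in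 B\mid\mathcal F_s]=\mathbb Q[\xi_t\in B\mid\xi_s]\quad\text{almost surely.}$$ -/

import Mathlib

open MeasureTheory ProbabilityTheory
open scoped NNReal

/-- A standard gamma process with growth rate `m` on the probability space `(Ω, P)`: a real-valued
process `(γ_t)_{t ≥ 0}` with independent increments, `γ_0 = 0` almost surely, and such that for
`t > 0` the random variable `γ_t` has density `x ^ (m t - 1) e ^ (-x) / Γ(m t)` on `x > 0`. -/
structure IsStandardGammaProcess {Ω : Type*} [MeasurableSpace Ω] (m : ℝ) (γ : ℝ≥0 → Ω → ℝ)
    (P : Measure Ω) : Prop where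
  measurable : ∀ t, Measurable (γ t)
  indepIncrements : HasIndepIncrements γ P
  zero : ∀ᵐ ω ∂P, γ 0 ω = 0
  law : ∀ t : ℝ≥0, 0 < t → HasLaw (γ t) (gammaMeasure (m * t) 1) P

/-- A standard gamma bridge over `[0, T]` with parameter `m`: any process indexed by `[0, T]` that
has the law (on the product space of paths) of `(γ_t / γ_T)_{0 ≤ t ≤ T}`, where `γ` is a standard
gamma process with growth rate `m`, on a possibly different probability space. -/
structure IsStandardGammaBridge {Ω : Type*} [MeasurableSpace Ω] (m : ℝ) (T : ℝ≥0)
    (Y : Set.Icc (0 : ℝ≥0) T → Ω → ℝ) (P : Measure Ω) : Prop where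
  measurable : ∀ t, Measurable (Y t)
  law : ∃ (Ω' : Type) (_ : MeasurableSpace Ω') (P' : Measure Ω') (γ : ℝ≥0 → Ω' → ℝ),
    IsProbabilityMeasure P' ∧ IsStandardGammaProcess m γ P' ∧
      IdentDistrib (fun ω t ↦ Y t ω)
        (fun ω (t : Set.Icc (0 : ℝ≥0) T) ↦ γ (t : ℝ≥0) ω / γ T ω) P P'

/-- The (elementary) Markov property of the real-valued process `ξ` with respect to the filtration
`ℱ`: `ξ` is adapted, and for all `s ≤ t` and all Borel sets `B`, almost surely
`P[ξ_t ∈ B | ℱ_s] = P[ξ_t ∈ B | ξ_s]`. -/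
structure HasMarkovProperty {Ω ι : Type*} [mΩ : MeasurableSpace Ω] [Preorder ι]
    (ξ : ι → Ω → ℝ) (ℱ : Filtration ι mΩ) (P : Measure Ω) : Prop where
  adapted : ∀ t, Measurable[ℱ t] (ξ t)
  markov : ∀ s t, s ≤ t → ∀ B : Set ℝ, MeasurableSet B →
    P⟦ξ t ⁻¹' B | ℱ s⟧ =ᵐ[P] P⟦ξ t ⁻¹' B | MeasurableSpace.comap (ξ s) inferInstance⟧

/-!
For independent gamma variables with common scale, tilting the law by `exp (θ S)`, where `S` is
their sum, has the same effect as multiplying all of them by `(1 - θ)⁻¹`, as one sees on moment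
generating functions. Tilting by `S` therefore does not change the law of a scale-invariant
function of the variables, which forces that function to be independent of `S` (Lukacs).

Applied to the increments of a gamma process `γ`, this makes the ratios `γ u / γ s`, `u ≤ s`,
independent of `γ s`, hence, by independence of increments, of `(γ v)` for `v ≥ s`. For the bridge
`Y` it follows that `ξ u = ξ s * (Y u / Y s)` for `u ≤ s`, where the ratios are independent of the
pair `(ξ s, ξ t)`. Up to null sets, the past of `ξ` at time `s` thus adds to `σ(ξ s)` only
information independent of `(ξ s, ξ t)`.
-/

open Filter
open scoped Topology

section CondExp

variable {Ω E : Type*} {m₁ m₂ m mΩ : MeasurableSpace Ω} {P : Measure Ω} [NormedAddCommGroup E]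
  [NormedSpace ℝ E] {f : Ω → E}

theorem generateFrom_image2_inter_measurableSet (m₁ m₂ : MeasurableSpace Ω) :
    MeasurableSpace.generateFrom
      (Set.image2 (· ∩ ·) {s | MeasurableSet[m₁] s} {t | MeasurableSet[m₂] t}) = m₁ ⊔ m₂ := by
  refine le_antisymm (MeasurableSpace.generateFrom_le ?_) (sup_le (fun s hs ↦ ?_) fun t ht ↦ ?_)
  · rintro _ ⟨s, hs, t, ht, rfl⟩
    exact .inter (le_sup_left (a := m₁) s hs) (le_sup_right (a := m₁) t ht)
  · exact MeasurableSpace.measurableSet_generateFrom ⟨s, hs, Set.univ, .univ, Set.inter_univ s⟩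
  · exact MeasurableSpace.measurableSet_generateFrom ⟨Set.univ, .univ, t, ht, Set.univ_inter t⟩

theorem isPiSystem_image2_inter_measurableSet (m₁ m₂ : MeasurableSpace Ω) :
    IsPiSystem (Set.image2 (· ∩ ·) {s | MeasurableSet[m₁] s} {t | MeasurableSet[m₂] t}) := by
  rintro _ ⟨s, hs, t, ht, rfl⟩ _ ⟨s', hs', t', ht', rfl⟩ -
  exact ⟨s ∩ s', .inter hs hs', t ∩ t', .inter ht ht', Set.inter_inter_inter_comm s s' t t'⟩

theorem setIntegral_eq_of_forall_inter {g : Ω → E} (hm₁ : m₁ ≤ mΩ) (hm₂ : m₂ ≤ mΩ)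
    (hf : Integrable f P) (hg : Integrable g P)
    (h : ∀ s t, MeasurableSet[m₁] s → MeasurableSet[m₂] t →
      ∫ ω in s ∩ t, f ω ∂P = ∫ ω in s ∩ t, g ω ∂P)
    {A : Set Ω} (hA : MeasurableSet[m₁ ⊔ m₂] A) :
    ∫ ω in A, f ω ∂P = ∫ ω in A, g ω ∂P := by
  have hle : m₁ ⊔ m₂ ≤ mΩ := sup_le hm₁ hm₂
  have huniv : ∫ ω, f ω ∂P = ∫ ω, g ω ∂P := by simpa using h _ _ .univ .univ
  induction A, hA using MeasurableSpace.induction_on_inter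
    (generateFrom_image2_inter_measurableSet m₁ m₂).symm
    (isPiSystem_image2_inter_measurableSet m₁ m₂) with
  | empty => simp
  | basic A hA =>
    obtain ⟨s, hs, t, ht, rfl⟩ := hA
    exact h s t hs ht
  | compl A hA ih =>
    rw [setIntegral_compl (hle A hA) hf, setIntegral_compl (hle A hA) hg, ih, huniv]
  | iUnion A hdisj hA ih =>
    have hA' := fun i ↦ hle _ (hA i)
    rw [integral_iUnion hA' hdisj hf.integrableOn, integral_iUnion hA' hdisj hg.integrableOn]
    exact tsum_congr ih

theorem setIntegral_eq_of_indep [CompleteSpace E] [IsProbabilityMeasure P] (hm₁ : m₁ ≤ mΩ)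
    (hm₂ : m₂ ≤ mΩ) (h : Indep m₁ m₂ P) (hf : StronglyMeasurable[m₁] f)
    (hfi : Integrable f P) {t : Set Ω} (ht : MeasurableSet[m₂] t) :
    ∫ ω in t, f ω ∂P = P.real t • ∫ ω, f ω ∂P := by
  rw [← setIntegral_condExp hm₂ hfi ht,
    setIntegral_congr_ae (hm₂ t ht) ((condExp_indep_eq hm₁ hm₂ hf h).mono fun _ hω _ ↦ hω),
    setIntegral_const]

theorem condExp_sup_ae_eq_of_indep [CompleteSpace E] [IsProbabilityMeasure P] (hm : m ≤ mΩ)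
    (hm₂ : m₂ ≤ mΩ) (hm₁ : m₁ ≤ m) (h : Indep m m₂ P) (hf : StronglyMeasurable[m] f)
    (hfi : Integrable f P) :
    P[f | m₁ ⊔ m₂] =ᵐ[P] P[f | m₁] := by
  have hm₁' : m₁ ≤ mΩ := hm₁.trans hm
  have hcond : StronglyMeasurable[m₁] (P[f | m₁]) := stronglyMeasurable_condExp
  have hle : m₁ ≤ m₁ ⊔ m₂ := le_sup_left
  have hinter {g : Ω → E} (hg : StronglyMeasurable[m] g) (hgi : Integrable g P) {s t : Set Ω}
      (hs : MeasurableSet[m₁] s) (ht : MeasurableSet[m₂] t) :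
      ∫ ω in s ∩ t, g ω ∂P = P.real t • ∫ ω in s, g ω ∂P := by
    rw [Set.inter_comm, ← setIntegral_indicator (hm₁' s hs),
      setIntegral_eq_of_indep hm hm₂ h (hg.indicator (hm₁ s hs)) (hgi.indicator (hm₁' s hs)) ht,
      integral_indicator (hm₁' s hs)]
  refine (ae_eq_condExp_of_forall_setIntegral_eq (sup_le hm₁' hm₂) hfi
    (fun _ _ _ ↦ integrable_condExp.integrableOn) (fun A hA _ ↦ ?_)
    (hcond.mono hle).aestronglyMeasurable).symm
  refine setIntegral_eq_of_forall_inter hm₁' hm₂ integrable_condExp hfi (fun s t hs ht ↦ ?_) hA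
  rw [hinter (hcond.mono hm₁) integrable_condExp hs ht, hinter hf hfi hs ht,
    setIntegral_condExp hm₁' hfi hs]

theorem condExp_ae_eq_of_le_eventuallyMeasurableSpace [CompleteSpace E] [IsFiniteMeasure P]
    (hm : m ≤ mΩ) (hm₂ : m₂ ≤ mΩ) (hm₁ : m₁ ≤ m) (hmm₂ : m ≤ eventuallyMeasurableSpace m₂ (ae P))
    (hf : Integrable f P) (h : P[f | m₂] =ᵐ[P] P[f | m₁]) :
    P[f | m] =ᵐ[P] P[f | m₁] := by
  refine (ae_eq_condExp_of_forall_setIntegral_eq hm hf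
    (fun _ _ _ ↦ integrable_condExp.integrableOn) (fun A hA _ ↦ ?_)
    (stronglyMeasurable_condExp.mono hm₁).aestronglyMeasurable).symm
  obtain ⟨A', hA', hAA'⟩ := hmm₂ A hA
  calc ∫ ω in A, (P[f | m₁]) ω ∂P
    _ = ∫ ω in A', (P[f | m₁]) ω ∂P := setIntegral_congr_set hAA'
    _ = ∫ ω in A', (P[f | m₂]) ω ∂P := integral_congr_ae (ae_restrict_of_ae h.symm)
    _ = ∫ ω in A', f ω ∂P := setIntegral_condExp hm₂ hf hA'
    _ = ∫ ω in A, f ω ∂P := (setIntegral_congr_set hAA').symm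

end CondExp

section Markov

variable {Ω : Type*} {mΩ : MeasurableSpace Ω} {P : Measure Ω}

theorem comap_le_eventuallyMeasurableSpace {α : Type*} [MeasurableSpace α] {m : MeasurableSpace Ω}
    {Z Z' : Ω → α} (hZ' : Measurable[m] Z') (h : Z =ᵐ[P] Z') :
    MeasurableSpace.comap Z inferInstance ≤ eventuallyMeasurableSpace m (ae P) :=
  (hZ'.eventuallyMeasurable_of_eventuallyEq h).comap_le

theorem condExp_comap_sup_comap_ae_eq_of_indepFun [IsProbabilityMeasure P] {α β δ : Type*}
    [MeasurableSpace α] [MeasurableSpace β] [MeasurableSpace δ] {S : Ω → α} {V : Ω → β} {R : Ω → δ}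
    (hS : Measurable S) (hV : Measurable V) (hR : Measurable R)
    (h : IndepFun R (fun ω ↦ (S ω, V ω)) P) {B : Set β} (hB : MeasurableSet B) :
    P⟦V ⁻¹' B | MeasurableSpace.comap S inferInstance ⊔ MeasurableSpace.comap R inferInstance⟧
      =ᵐ[P] P⟦V ⁻¹' B | MeasurableSpace.comap S inferInstance⟧ := by
  have hSV : Measurable[MeasurableSpace.comap (fun ω ↦ (S ω, V ω)) inferInstance]
      fun ω ↦ (S ω, V ω) := comap_measurable _
  refine condExp_sup_ae_eq_of_indep (hS.prodMk hV).comap_le hR.comap_le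
    (measurable_fst.comp hSV).comap_le h.symm ?_
    ((integrable_const 1).indicator (hV hB))
  exact stronglyMeasurable_const.indicator (measurable_snd.comp hSV hB)

theorem hasMarkovProperty_natural_of_indepFun [IsProbabilityMeasure P] {ι : Type*} [Preorder ι]
    {ξ : ι → Ω → ℝ} (hξ : ∀ t, Measurable (ξ t)) {R : ∀ s, Set.Iic s → Ω → ℝ}
    (hR : ∀ s u, Measurable (R s u))
    (hfact : ∀ s (u : Set.Iic s), ξ u =ᵐ[P] fun ω ↦ ξ s ω * R s u ω)
    (hind : ∀ s t, s ≤ t → IndepFun (fun ω u ↦ R s u ω) (fun ω ↦ (ξ s ω, ξ t ω)) P) :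
    HasMarkovProperty ξ (Filtration.natural ξ fun t ↦ (hξ t).stronglyMeasurable) P := by
  set ℱ := Filtration.natural ξ fun t ↦ (hξ t).stronglyMeasurable
  have hξℱ {u s : ι} (hus : u ≤ s) : MeasurableSpace.comap (ξ u) inferInstance ≤ ℱ s :=
    le_iSup₂ (f := fun j (_ : j ≤ s) ↦ MeasurableSpace.comap (ξ j) inferInstance) u hus
  refine ⟨fun t ↦ Measurable.of_comap_le (hξℱ le_rfl), fun s t hst B hB ↦ ?_⟩
  have hRs : Measurable fun ω u ↦ R s u ω := measurable_pi_lambda _ (hR s)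
  set m := MeasurableSpace.comap (ξ s) inferInstance ⊔
    MeasurableSpace.comap (fun ω u ↦ R s u ω) inferInstance
  have hprod (u : Set.Iic s) : Measurable[m] fun ω ↦ ξ s ω * R s u ω :=
    ((comap_measurable (ξ s)).mono le_sup_left le_rfl).mul
      (((measurable_pi_apply u).comp (comap_measurable fun ω u ↦ R s u ω)).mono le_sup_right le_rfl)
  exact condExp_ae_eq_of_le_eventuallyMeasurableSpace (ℱ.le s)
    (sup_le (hξ s).comap_le hRs.comap_le) (hξℱ le_rfl)
    (iSup₂_le fun u hus ↦ comap_le_eventuallyMeasurableSpace (hprod ⟨u, hus⟩) (hfact s ⟨u, hus⟩))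
    ((integrable_const 1).indicator (hξ t hB))
    (condExp_comap_sup_comap_ae_eq_of_indepFun (hξ s) (hξ t) hRs (hind s t hst) hB)

end Markov

theorem frequently_complexMGF_eq_of_mgf_eventuallyEq {Ω Ω' : Type*} {mΩ : MeasurableSpace Ω}
    {mΩ' : MeasurableSpace Ω'} {X : Ω → ℝ} {Y : Ω' → ℝ} {μ : Measure Ω} {ν : Measure Ω'}
    (h : mgf X μ =ᶠ[𝓝 0] mgf Y ν) :
    ∃ᶠ z in 𝓝[≠] (0 : ℂ), complexMGF X μ z = complexMGF Y ν z := by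
  have hreal : ∀ᶠ t : ℝ in 𝓝[≠] 0, complexMGF X μ t = complexMGF Y ν t := by
    filter_upwards [h.filter_mono nhdsWithin_le_nhds] with t ht
    rw [complexMGF_ofReal, complexMGF_ofReal, ht]
  have hcoe : Tendsto ((↑) : ℝ → ℂ) (𝓝[≠] 0) (𝓝[≠] 0) :=
    Complex.continuous_ofReal.continuousWithinAt.tendsto_nhdsWithin fun t ht ↦ by simpa using ht
  exact hcoe.frequently hreal.frequently

theorem zero_mem_interior_integrableExpSet {Ω : Type*} {mΩ : MeasurableSpace Ω} {X : Ω → ℝ}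
    {μ : Measure Ω} (h : ∀ᶠ t in 𝓝 0, 0 < mgf X μ t) :
    0 ∈ interior (integrableExpSet X μ) :=
  mem_interior_iff_mem_nhds.2 <| h.mono fun _ ht ↦ by
    by_contra hint
    exact ht.ne' (mgf_undef hint)

theorem measure_ext_of_mgf_eventuallyEq {μ ν : Measure ℝ} [IsFiniteMeasure μ] [IsFiniteMeasure ν]
    (hpos : ∀ᶠ t in 𝓝 0, 0 < mgf id μ t) (h : mgf id μ =ᶠ[𝓝 0] mgf id ν) : μ = ν := by
  set I := interior (integrableExpSet id μ) ∩ interior (integrableExpSet id ν)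
  have hI : 0 ∈ I := by
    refine ⟨zero_mem_interior_integrableExpSet hpos, zero_mem_interior_integrableExpSet ?_⟩
    filter_upwards [hpos, h] with t ht htt using htt ▸ ht
  have hconv : Convex ℝ I :=
    convex_integrableExpSet.interior.inter convex_integrableExpSet.interior
  have hstrip : Set.EqOn (complexMGF id μ) (complexMGF id ν) (Complex.re ⁻¹' I) :=
    (analyticOnNhd_complexMGF.mono fun z hz ↦ hz.1).eqOn_of_preconnected_of_frequently_eq
      (analyticOnNhd_complexMGF.mono fun z hz ↦ hz.2)
      (hconv.linear_preimage Complex.reLm).isPreconnected (z₀ := 0) (by simpa using hI)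
      (frequently_complexMGF_eq_of_mgf_eventuallyEq h)
  refine Measure.ext_of_charFun (funext fun t ↦ ?_)
  have ht := hstrip (x := t * Complex.I) (by simpa using hI)
  rwa [complexMGF_mul_I aemeasurable_id, complexMGF_mul_I aemeasurable_id, Measure.map_id,
    Measure.map_id] at ht

theorem indepFun_prodMk_of_indepFun_prodMk {Ω α β δ : Type*} {mΩ : MeasurableSpace Ω}
    {P : Measure Ω} [IsProbabilityMeasure P] [MeasurableSpace α] [MeasurableSpace β]
    [MeasurableSpace δ] {R : Ω → α} {X : Ω → β} {W : Ω → δ}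
    (hR : Measurable R) (hX : Measurable X) (hW : Measurable W) (hRW : IndepFun R W P)
    (h : IndepFun X (fun ω ↦ (R ω, W ω)) P) :
    IndepFun R (fun ω ↦ (X ω, W ω)) P := by
  have hXW : IndepFun X W P := h.comp measurable_id measurable_snd
  have := Measure.isProbabilityMeasure_map (μ := P) hX.aemeasurable
  have := Measure.isProbabilityMeasure_map (μ := P) hW.aemeasurable
  rw [indepFun_iff_map_prod_eq_prod_map_map (by fun_prop) (by fun_prop),
    (indepFun_iff_map_prod_eq_prod_map_map (by fun_prop) (by fun_prop)).1 hXW]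
  refine Measure.ext_prod₃ fun {A B C} hA hB hC ↦ ?_
  rw [Measure.map_apply (by fun_prop) (hA.prod (hB.prod hC)), Measure.prod_prod,
    Measure.prod_prod, Measure.map_apply hR hA, Measure.map_apply hX hB, Measure.map_apply hW hC]
  calc P ((fun ω ↦ (R ω, X ω, W ω)) ⁻¹' A ×ˢ B ×ˢ C)
    _ = P (X ⁻¹' B ∩ (fun ω ↦ (R ω, W ω)) ⁻¹' A ×ˢ C) := by congr 1; ext; simp; tauto
    _ = P (X ⁻¹' B) * P (R ⁻¹' A ∩ W ⁻¹' C) := h.measure_inter_preimage_eq_mul _ _ hB (hA.prod hC)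
    _ = P (R ⁻¹' A) * (P (X ⁻¹' B) * P (W ⁻¹' C)) := by
      rw [hRW.measure_inter_preimage_eq_mul _ _ hA hC, mul_left_comm]

section Tilted

variable {Ω E : Type*} {mΩ : MeasurableSpace Ω} [MeasurableSpace E] {P : Measure Ω}

theorem integrable_of_tilted_ne_zero {f : Ω → ℝ} (h : P.tilted f ≠ 0) :
    Integrable (fun ω ↦ Real.exp (f ω)) P := by
  by_contra hf
  exact h (tilted_of_not_integrable hf)

theorem mgf_cond_of_tilted_apply_eq [IsProbabilityMeasure P] {S : Ω → ℝ} {θ : ℝ} {A : Set Ω}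
    (hA : MeasurableSet A) (hPA : P A ≠ 0) (h : P.tilted (fun ω ↦ θ * S ω) A = P A) :
    mgf S P[|A] θ = mgf S P θ := by
  have hint : Integrable (fun ω ↦ Real.exp (θ * S ω)) P :=
    integrable_of_tilted_ne_zero fun h0 ↦ hPA (by rw [← h, h0]; rfl)
  have hmgf : 0 < mgf S P θ := mgf_pos hint
  have hreal : P.real A = (∫ ω in A, Real.exp (θ * S ω) ∂P) / mgf S P θ := by
    rw [← integral_div, measureReal_def, ← h, tilted_mul_apply_eq_ofReal_integral_mgf' hA,
      ENNReal.toReal_ofReal (integral_nonneg fun ω ↦ by positivity)]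
  have hPA' : P.real A ≠ 0 := (measureReal_ne_zero_iff).2 hPA
  rw [mgf, ProbabilityTheory.cond, integral_smul_measure, ENNReal.toReal_inv, ← measureReal_def,
    smul_eq_mul, inv_mul_eq_iff_eq_mul₀ hPA', hreal, div_mul_cancel₀ _ hmgf.ne']

theorem indepFun_of_map_tilted_eq [IsProbabilityMeasure P] {R : Ω → E} {S : Ω → ℝ}
    (hR : Measurable R) (hS : Measurable S)
    (h : ∀ᶠ θ in 𝓝 0, (P.tilted fun ω ↦ θ * S ω).map R = P.map R) : IndepFun R S P := by
  have hpos : ∀ᶠ θ in 𝓝 0, 0 < mgf id (P.map S) θ := by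
    filter_upwards [h] with θ hθ
    have := Measure.isProbabilityMeasure_map (μ := P) hR.aemeasurable
    rw [mgf_id_map hS.aemeasurable]
    refine mgf_pos (integrable_of_tilted_ne_zero fun h0 ↦ ?_)
    rw [h0, Measure.map_zero] at hθ
    exact IsProbabilityMeasure.ne_zero _ hθ.symm
  refine indepFun_iff_measure_inter_preimage_eq_mul.2 fun C B hC hB ↦ ?_
  have hA : MeasurableSet (R ⁻¹' C) := hR hC
  rcases eq_or_ne (P (R ⁻¹' C)) 0 with hPA | hPA
  · rw [measure_mono_null Set.inter_subset_left hPA, hPA, zero_mul]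
  have hlaw : P.map S = P[|R ⁻¹' C].map S := by
    have := cond_isProbabilityMeasure hPA
    refine measure_ext_of_mgf_eventuallyEq hpos ?_
    filter_upwards [h] with θ hθ
    rw [mgf_id_map hS.aemeasurable, mgf_id_map hS.aemeasurable,
      mgf_cond_of_tilted_apply_eq hA hPA]
    rw [← Measure.map_apply hR hC, ← Measure.map_apply hR hC, hθ]
  rw [← Measure.map_apply hS hB, hlaw, Measure.map_apply hS hB, mul_comm,
    cond_mul_eq_inter hA]

theorem mgf_tilted_mul {X : Ω → ℝ} (t u : ℝ) :
    mgf X (P.tilted fun ω ↦ t * X ω) u = mgf X P (t + u) / mgf X P t :=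
  calc mgf X (P.tilted fun ω ↦ t * X ω) u
    _ = ∫ ω, (Real.exp (t * X ω) / mgf X P t) • Real.exp (u * X ω) ∂P :=
      integral_tilted_mul_eq_mgf _
    _ = ∫ ω, Real.exp ((t + u) * X ω) / mgf X P t ∂P := by
      simp only [smul_eq_mul, add_mul, Real.exp_add, div_mul_eq_mul_div]
    _ = mgf X P (t + u) / mgf X P t := integral_div _ _

theorem map_tilted_comp {g : Ω → E} (hg : Measurable g) {f : E → ℝ} (hf : Measurable f) :
    (P.tilted fun ω ↦ f (g ω)).map g = (P.map g).tilted f := by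
  ext A hA
  rw [Measure.map_apply hg hA, tilted_apply' _ _ (hg hA), tilted_apply' _ _ hA,
    setLIntegral_map hA (by fun_prop) hg, integral_map hg.aemeasurable (by fun_prop)]

theorem pi_tilted {ι : Type*} [Fintype ι] {α : ι → Type*} [∀ i, MeasurableSpace (α i)]
    (μ : ∀ i, Measure (α i)) [∀ i, SigmaFinite (μ i)] (f : ∀ i, α i → ℝ) :
    (Measure.pi μ).tilted (fun x ↦ ∑ i, f i (x i)) = Measure.pi fun i ↦ (μ i).tilted (f i) := by
  refine (Measure.pi_eq fun s hs ↦ ?_).symm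
  have hnonneg (i : ι) : 0 ≤ ∫ x in s i, Real.exp (f i x) / ∫ y, Real.exp (f i y) ∂(μ i) ∂(μ i) :=
    integral_nonneg fun x ↦ by positivity
  simp_rw [tilted_apply_eq_ofReal_integral' _ (hs _)]
  rw [tilted_apply_eq_ofReal_integral' _ (MeasurableSet.univ_pi hs),
    ← ENNReal.ofReal_prod_of_nonneg fun i _ ↦ hnonneg i, Measure.restrict_pi_pi,
    ← integral_fintype_prod_eq_prod]
  simp_rw [Real.exp_sum, Finset.prod_div_distrib, ← integral_fintype_prod_eq_prod]

end Tilted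

section Gamma

variable {Ω : Type*} {mΩ : MeasurableSpace Ω} {P : Measure Ω} {X Y : Ω → ℝ} {b c t : ℝ}

theorem integral_gammaPDFReal_eq_one {a r : ℝ} (ha : 0 < a) (hr : 0 < r) :
    ∫ x, gammaPDFReal a r x = 1 := by
  rw [integral_eq_lintegral_of_nonneg_ae (.of_forall (gammaPDFReal_nonneg ha hr))
    (stronglyMeasurable_gammaPDFReal a r).aestronglyMeasurable]
  exact congrArg ENNReal.toReal (lintegral_gammaPDF_eq_one ha hr)

theorem gammaPDFReal_mul_exp {a r : ℝ} (hr : 0 < r) (ht : t < r) (x : ℝ) :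
    gammaPDFReal a r x * Real.exp (t * x) = (1 - t / r) ^ (-a) * gammaPDFReal a (r - t) x := by
  have hrt : 0 < r - t := sub_pos.2 ht
  simp only [gammaPDFReal]
  split_ifs with hx
  · have hscale : (1 - t / r) ^ (-a) * (r - t) ^ a = r ^ a := by
      rw [one_sub_div hr.ne', Real.rpow_neg (by positivity), Real.div_rpow hrt.le hr.le]
      field_simp
    have hexp : Real.exp (-(r * x)) * Real.exp (t * x) = Real.exp (-((r - t) * x)) := by
      rw [← Real.exp_add]
      ring_nf
    rw [mul_assoc, hexp, ← hscale]
    ring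
  · simp

theorem mgf_id_gammaMeasure {a r : ℝ} (ha : 0 < a) (hr : 0 < r) (ht : t < r) :
    mgf id (gammaMeasure a r) t = (1 - t / r) ^ (-a) :=
  calc mgf id (gammaMeasure a r) t
    _ = ∫ x, gammaPDFReal a r x * Real.exp (t * x) := by
      rw [mgf, gammaMeasure, integral_withDensity_eq_integral_toReal_smul (f := gammaPDF a r)
        (measurable_gammaPDFReal a r).ennreal_ofReal (.of_forall fun _ ↦ ENNReal.ofReal_lt_top)]
      simp only [gammaPDF, ENNReal.toReal_ofReal (gammaPDFReal_nonneg ha hr _), id, smul_eq_mul]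
    _ = ∫ x, (1 - t / r) ^ (-a) * gammaPDFReal a (r - t) x := by
      simp only [gammaPDFReal_mul_exp hr ht]
    _ = (1 - t / r) ^ (-a) := by
      rw [integral_const_mul, integral_gammaPDFReal_eq_one ha (sub_pos.2 ht), mul_one]

theorem ae_pos_gammaMeasure (a r : ℝ) : ∀ᵐ x ∂gammaMeasure a r, 0 < x := by
  have hIic : gammaMeasure a r (Set.Iic 0) = 0 := by
    rw [gammaMeasure, withDensity_apply _ measurableSet_Iic, setLIntegral_congr Iio_ae_eq_Iic.symm]
    exact lintegral_gammaPDF_of_nonpos le_rfl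
  filter_upwards [measure_eq_zero_iff_ae_notMem.1 hIic] with x hx using not_le.1 hx

/-- The random variable `X` has the moment generating function of the gamma law of shape `b` and
rate `1`. Unlike `gammaMeasure b 1`, this makes sense for `b = 0`, where it describes the unit mass
at `0`; zero-length increments of a gamma process are thereby covered. -/
def HasGammaMGF (X : Ω → ℝ) (b : ℝ) (P : Measure Ω) : Prop :=
  ∀ t < 1, mgf X P t = (1 - t) ^ (-b)

namespace HasGammaMGF

theorem of_hasLaw_gammaMeasure (hb : 0 < b) (hX : HasLaw X (gammaMeasure b 1) P) :
    HasGammaMGF X b P := fun t ht ↦ by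
  rw [← mgf_id_map hX.aemeasurable, hX.map_eq, mgf_id_gammaMeasure hb one_pos ht, div_one]

theorem of_ae_eq_zero [IsProbabilityMeasure P] (hX : ∀ᵐ ω ∂P, X ω = 0) : HasGammaMGF X 0 P :=
  fun t _ ↦ by
    rw [mgf_congr hX]
    simp

theorem sub_of_indepFun (hX : HasGammaMGF X b P) (hXY : HasGammaMGF Y c P)
    (hXm : AEMeasurable X P) (hYm : AEMeasurable Y P) (hind : IndepFun X (Y - X) P) :
    HasGammaMGF (Y - X) (c - b) P := fun t ht ↦ by
  have ht' : 0 < 1 - t := sub_pos.2 ht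
  have hmul : mgf Y P t = mgf X P t * mgf (Y - X) P t := by
    rw [← hind.mgf_add' (by fun_prop) (by fun_prop), add_sub_cancel]
  rw [hX t ht, hXY t ht] at hmul
  have hexp : -(c - b) = b + -c := by ring
  rw [hexp, Real.rpow_add ht', hmul, ← mul_assoc, ← Real.rpow_add ht']
  simp

theorem map_tilted_eq_map_mul [IsProbabilityMeasure P] (hX : HasGammaMGF X b P)
    (hXm : AEMeasurable X P) {θ : ℝ} (hθ : θ < 1) :
    (P.map X).tilted (fun x ↦ θ * x) = (P.map X).map (fun x ↦ (1 - θ)⁻¹ * x) := by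
  have hθ' : 0 < 1 - θ := sub_pos.2 hθ
  have := Measure.isProbabilityMeasure_map hXm
  have hscaled (u : ℝ) : mgf id ((P.map X).map fun x ↦ (1 - θ)⁻¹ * x) u =
      mgf X P ((1 - θ)⁻¹ * u) := by
    rw [mgf_id_map (by fun_prop), ← mgf_id_map hXm]
    exact mgf_const_mul _
  have htilted (u : ℝ) (hu : u < 1 - θ) : mgf id ((P.map X).tilted fun x ↦ θ * x) u =
      (1 - (1 - θ)⁻¹ * u) ^ (-b) := by
    have hmul : 1 - (θ + u) = (1 - θ) * (1 - (1 - θ)⁻¹ * u) := by field_simp; ring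
    have hpos : 0 ≤ 1 - (1 - θ)⁻¹ * u := by
      rw [sub_nonneg, inv_mul_le_iff₀ hθ', mul_one]; exact hu.le
    calc mgf id ((P.map X).tilted fun x ↦ θ * x) u
      _ = mgf X P (θ + u) / mgf X P θ := by rw [← mgf_id_map hXm]; exact mgf_tilted_mul θ u
      _ = ((1 - θ) * (1 - (1 - θ)⁻¹ * u)) ^ (-b) / (1 - θ) ^ (-b) := by
        rw [hX θ hθ, hX (θ + u) (by linarith), hmul]
      _ = (1 - (1 - θ)⁻¹ * u) ^ (-b) := by
        rw [Real.mul_rpow hθ'.le hpos, mul_div_cancel_left₀ _ (by positivity)]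
  refine (measure_ext_of_mgf_eventuallyEq ?_ ?_).symm
  all_goals filter_upwards [Iio_mem_nhds hθ'] with u hu
  all_goals have hu' : (1 - θ)⁻¹ * u < 1 := by rwa [inv_mul_lt_iff₀ hθ', mul_one]
  all_goals rw [hscaled, hX _ hu']
  · exact Real.rpow_pos_of_pos (sub_pos.2 hu') _
  · exact (htilted u hu).symm

end HasGammaMGF

section Lukacs

variable {ι : Type*} [Fintype ι] {D : ι → Ω → ℝ} {b : ι → ℝ} [IsProbabilityMeasure P]

theorem map_tilted_sum_eq_map_smul (hD : ∀ i, Measurable (D i)) (hind : iIndepFun D P)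
    (hmgf : ∀ i, HasGammaMGF (D i) (b i) P) {θ : ℝ} (hθ : θ < 1) :
    (P.tilted fun ω ↦ θ * ∑ i, D i ω).map (fun ω i ↦ D i ω) =
      (P.map fun ω i ↦ D i ω).map fun x ↦ (1 - θ)⁻¹ • x := by
  have hlaw : P.map (fun ω i ↦ D i ω) = Measure.pi fun i ↦ P.map (D i) :=
    (iIndepFun_iff_map_fun_eq_pi_map fun i ↦ (hD i).aemeasurable).1 hind
  have (i : ι) : IsProbabilityMeasure (P.map (D i)) :=
    Measure.isProbabilityMeasure_map (hD i).aemeasurable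
  calc (P.tilted fun ω ↦ θ * ∑ i, D i ω).map (fun ω i ↦ D i ω)
    _ = (P.map fun ω i ↦ D i ω).tilted fun x ↦ θ * ∑ i, x i :=
      map_tilted_comp (g := fun ω i ↦ D i ω) (f := fun x : ι → ℝ ↦ θ * ∑ i, x i)
        (measurable_pi_lambda _ hD) (by fun_prop)
    _ = Measure.pi fun i ↦ (P.map (D i)).tilted fun x ↦ θ * x := by
      simp_rw [hlaw, Finset.mul_sum, ← pi_tilted _ fun _ x ↦ θ * x]
    _ = Measure.pi fun i ↦ (P.map (D i)).map fun x ↦ (1 - θ)⁻¹ * x := by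
      simp_rw [fun i ↦ (hmgf i).map_tilted_eq_map_mul (hD i).aemeasurable hθ]
    _ = (P.map fun ω i ↦ D i ω).map fun x ↦ (1 - θ)⁻¹ • x := by
      rw [hlaw, ← Measure.pi_map_pi fun _ ↦ by fun_prop]
      rfl

theorem indepFun_sum_of_scale_invariant {E : Type*} [MeasurableSpace E]
    (hD : ∀ i, Measurable (D i)) (hind : iIndepFun D P)
    (hmgf : ∀ i, HasGammaMGF (D i) (b i) P) {Φ : (ι → ℝ) → E} (hΦ : Measurable Φ)
    (hscale : ∀ k : ℝ, 0 < k → ∀ x, Φ (k • x) = Φ x) :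
    IndepFun (fun ω ↦ Φ fun i ↦ D i ω) (fun ω ↦ ∑ i, D i ω) P := by
  have hDm : Measurable fun ω i ↦ D i ω := measurable_pi_lambda _ hD
  refine indepFun_of_map_tilted_eq (hΦ.comp hDm) (by fun_prop) ?_
  filter_upwards [Iio_mem_nhds one_pos] with θ hθ
  have hΦθ : (Φ ∘ fun x ↦ (1 - θ)⁻¹ • x) = Φ := funext (hscale _ (inv_pos.2 (sub_pos.2 hθ)))
  calc (P.tilted fun ω ↦ θ * ∑ i, D i ω).map (Φ ∘ fun ω i ↦ D i ω)
    _ = ((P.map fun ω i ↦ D i ω).map fun x ↦ (1 - θ)⁻¹ • x).map Φ := by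
      rw [← Measure.map_map hΦ hDm, map_tilted_sum_eq_map_smul hD hind hmgf hθ]
    _ = P.map (Φ ∘ fun ω i ↦ D i ω) := by
      rw [Measure.map_map hΦ (by fun_prop), hΦθ, Measure.map_map hΦ hDm]

end Lukacs

end Gamma

section IndepIncrements

variable {ι : Type*} [LinearOrder ι] [OrderBot ι]

theorem exists_monotone_enumeration (I : Finset ι) :
    ∃ (τ : ℕ → ι) (κ : ι → ℕ), Monotone τ ∧ τ 0 = ⊥ ∧ Monotone κ ∧ ∀ u ∈ I, τ (κ u) = u := by
  set κ : ι → ℕ := fun u ↦ (I.filter (· ≤ u)).card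
  have hκ : Monotone κ := fun u v huv ↦
    Finset.card_le_card (Finset.monotone_filter_right I fun _ _ h ↦ h.trans huv)
  have hκI {u v : ι} (hv : v ∈ I) (h : κ v ≤ κ u) : v ≤ u := by
    by_contra! huv
    have hfilter : I.filter (· ≤ u) = I.filter (· ≤ v) := Finset.eq_of_subset_of_card_le
      (Finset.monotone_filter_right I fun _ _ h ↦ h.trans huv.le) h
    exact huv.not_ge ((Finset.filter_inj'.1 hfilter hv).2 le_rfl)
  refine ⟨fun k ↦ (I.filter (κ · ≤ k)).sup id, κ, fun k l hkl ↦ ?_, ?_, hκ, fun u hu ↦ ?_⟩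
  · exact Finset.sup_mono (Finset.monotone_filter_right I fun _ _ h ↦ h.trans hkl)
  · suffices h : I.filter (κ · ≤ 0) = ∅ by simp only [h, Finset.sup_empty]
    refine Finset.filter_false_of_mem fun u hu ↦ ?_
    have hpos : 0 < κ u := Finset.card_pos.2 ⟨u, Finset.mem_filter.2 ⟨hu, le_rfl⟩⟩
    exact hpos.not_ge
  · refine le_antisymm (Finset.sup_le fun v hv ↦ ?_) (Finset.le_sup (f := id) (by simp [hu]))
    exact hκI (Finset.mem_filter.1 hv).1 (Finset.mem_filter.1 hv).2

theorem comap_pi_le_of_forall_measurable {Ω α : Type*} {β : α → Type*}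
    [∀ a, MeasurableSpace (β a)] {m : MeasurableSpace Ω} {Y : ∀ a, Ω → β a}
    (hY : ∀ a, Measurable (Y a)) : MeasurableSpace.comap (fun ω a ↦ Y a ω) inferInstance ≤ m :=
  (measurable_pi_lambda _ hY).comap_le

theorem indepFun_sub_bot_sub_of_hasIndepIncrements {Ω E : Type*} {mΩ : MeasurableSpace Ω}
    {P : Measure Ω} [IsZeroOrProbabilityMeasure P] [AddCommGroup E] [MeasurableSpace E]
    [MeasurableAdd₂ E] [MeasurableSub₂ E] {X : ι → Ω → E} (hX : HasIndepIncrements X P)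
    (hXm : ∀ t, Measurable (X t)) (s : ι) :
    IndepFun (fun ω (u : Set.Iic s) ↦ X u ω - X ⊥ ω)
      (fun ω (v : Set.Ici s) ↦ X v ω - X s ω) P := by
  classical
  refine IndepFun.process_indepFun_process (fun u ↦ by fun_prop) (fun v ↦ by fun_prop) fun I J ↦ ?_
  obtain ⟨τ, κ, hτ, hτ0, hκ, hτκ⟩ := exists_monotone_enumeration
    (insert s (I.image Subtype.val ∪ J.image Subtype.val))
  set D : ℕ → Ω → E := fun i ω ↦ X (τ (i + 1)) ω - X (τ i) ω
  have hsplit : Indep (⨆ i ∈ Set.Iio (κ s), MeasurableSpace.comap (D i) inferInstance)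
      (⨆ i ∈ Set.Ici (κ s), MeasurableSpace.comap (D i) inferInstance) P :=
    indep_iSup_of_disjoint (fun i ↦ Measurable.comap_le (by fun_prop)) (hX.nat hτ)
      (Set.Iio_disjoint_Ici le_rfl)
  have hsum {a b : ℕ} (hab : a ≤ b) {S : Set ℕ} (hS : Set.Ico a b ⊆ S) :
      Measurable[⨆ i ∈ S, MeasurableSpace.comap (D i) inferInstance]
        fun ω ↦ X (τ b) ω - X (τ a) ω := by
    have htel : (fun ω ↦ X (τ b) ω - X (τ a) ω) = fun ω ↦ ∑ i ∈ Finset.Ico a b, D i ω :=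
      funext fun ω ↦ (Finset.sum_Ico_sub (fun i ↦ X (τ i) ω) hab).symm
    rw [htel]
    refine Finset.measurable_fun_sum _ fun i hi ↦ (comap_measurable (D i)).mono ?_ le_rfl
    exact le_iSup₂ (f := fun i _ ↦ MeasurableSpace.comap (D i) inferInstance) i
      (hS (by simpa using hi))
  have hs : τ (κ s) = s := hτκ s (Finset.mem_insert_self _ _)
  refine indep_of_indep_of_le_left (indep_of_indep_of_le_right hsplit ?_) ?_ <;>
    refine comap_pi_le_of_forall_measurable fun u ↦ ?_
  · have hu : τ (κ u) = u := hτκ u (Finset.mem_insert_of_mem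
      (Finset.mem_union_right _ (Finset.mem_image_of_mem _ u.2)))
    simpa only [hs, hu] using hsum (hκ u.1.2) Set.Ico_subset_Ici_self
  · have hu : τ (κ u) = u := hτκ u (Finset.mem_insert_of_mem
      (Finset.mem_union_left _ (Finset.mem_image_of_mem _ u.2)))
    have hus : Set.Ico 0 (κ u) ⊆ Set.Iio (κ s) := fun i hi ↦ hi.2.trans_le (hκ u.1.2)
    simpa only [hu, hτ0] using hsum (Nat.zero_le _) hus

end IndepIncrements

theorem sum_fin_filter_lt_sub {E : Type*} [AddCommGroup E] (f : ℕ → E) {k n : ℕ} (hkn : k ≤ n) :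
    ∑ i : Fin n with i.val < k, (f (i + 1) - f i) = f k - f 0 := by
  have hrange : (Finset.range n).filter (· < k) = Finset.range k := by grind
  rw [← Finset.sum_range_sub f k, ← hrange, Finset.sum_filter, Finset.sum_filter,
    Fin.sum_univ_eq_sum_range fun i ↦ if i < k then f (i + 1) - f i else 0]

namespace IsStandardGammaProcess

variable {Ω : Type*} {mΩ : MeasurableSpace Ω} {P : Measure Ω} {m : ℝ} {γ : ℝ≥0 → Ω → ℝ}

theorem ae_pos (hγ : IsStandardGammaProcess m γ P) {t : ℝ≥0} (ht : 0 < t) :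
    ∀ᵐ ω ∂P, 0 < γ t ω := by
  refine ae_of_ae_map (hγ.measurable t).aemeasurable ?_
  rw [(hγ.law t ht).map_eq]
  exact ae_pos_gammaMeasure _ _

theorem ae_mul_div_cancel (hγ : IsStandardGammaProcess m γ P) {u s : ℝ≥0} (hus : u ≤ s) :
    ∀ᵐ ω ∂P, γ s ω * (γ u ω / γ s ω) = γ u ω := by
  rcases hus.eq_or_lt with rfl | hlt
  · exact .of_forall fun ω ↦ mul_div_cancel_of_imp' id
  · filter_upwards [hγ.ae_pos (zero_le.trans_lt hlt)] with ω hω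
    exact mul_div_cancel₀ _ hω.ne'

variable [IsProbabilityMeasure P]

theorem hasGammaMGF (hγ : IsStandardGammaProcess m γ P) (hm : 0 < m) (t : ℝ≥0) :
    HasGammaMGF (γ t) (m * t) P := by
  rcases eq_zero_or_pos t with rfl | ht
  · simpa using HasGammaMGF.of_ae_eq_zero hγ.zero
  · exact .of_hasLaw_gammaMeasure (by positivity) (hγ.law t ht)

theorem hasGammaMGF_sub (hγ : IsStandardGammaProcess m γ P) (hm : 0 < m) {s t : ℝ≥0}
    (hst : s ≤ t) : HasGammaMGF (γ t - γ s) (m * t - m * s) P :=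
  (hγ.hasGammaMGF hm s).sub_of_indepFun (hγ.hasGammaMGF hm t) (hγ.measurable s).aemeasurable
    (hγ.measurable t).aemeasurable
    (hγ.indepIncrements.indepFun_eval_sub zero_le hst hγ.zero)

theorem indepFun_div_self (hγ : IsStandardGammaProcess m γ P) (hm : 0 < m) (s : ℝ≥0) :
    IndepFun (fun ω (u : Set.Iic s) ↦ γ u ω / γ s ω) (γ s) P := by
  classical
  have hγm := hγ.measurable
  refine IndepFun.process_indepFun (fun u ↦ by fun_prop) (hγm s) fun I ↦ ?_
  obtain ⟨τ, κ, hτ, hτ0, hκ, hτκ⟩ := exists_monotone_enumeration (insert s (I.image Subtype.val))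
  have hs : τ (κ s) = s := hτκ s (Finset.mem_insert_self _ _)
  have hI (u : I) : τ (κ u) = u :=
    hτκ u (Finset.mem_insert_of_mem (Finset.mem_image_of_mem _ u.2))
  set D : ℕ → Ω → ℝ := fun i ω ↦ γ (τ (i + 1)) ω - γ (τ i) ω
  set Φ : (Fin (κ s) → ℝ) → I → ℝ := fun x u ↦ (∑ i with i.val < κ u, x i) / ∑ i, x i
  have hΦscale (k : ℝ) (hk : 0 < k) (x : Fin (κ s) → ℝ) : Φ (k • x) = Φ x := by
    simp only [Φ, Pi.smul_apply, smul_eq_mul, ← Finset.mul_sum, mul_div_mul_left _ _ hk.ne']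
  have hΦD : IndepFun (fun ω ↦ Φ fun i ↦ D i ω) (fun ω ↦ ∑ i : Fin (κ s), D i ω) P :=
    indepFun_sum_of_scale_invariant (D := fun i : Fin (κ s) ↦ D i) (fun i ↦ by fun_prop)
      ((hγ.indepIncrements.nat hτ).precomp Fin.val_injective)
      (fun i ↦ hγ.hasGammaMGF_sub hm (hτ (Nat.le_succ i))) (by fun_prop) hΦscale
  have hsum (ω : Ω) (hω : γ 0 ω = 0) {u : ℝ≥0} (hu : τ (κ u) = u) (hus : u ≤ s) :
      ∑ i : Fin (κ s) with i.val < κ u, D i ω = γ u ω := by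
    rw [sum_fin_filter_lt_sub (fun i ↦ γ (τ i) ω) (hκ hus), hu, hτ0, bot_eq_zero, hω, sub_zero]
  have htotal : (fun ω ↦ ∑ i : Fin (κ s), D i ω) =ᵐ[P] γ s := by
    filter_upwards [hγ.zero] with ω hω
    simpa using hsum ω hω hs le_rfl
  refine hΦD.congr ?_ htotal
  filter_upwards [hγ.zero, htotal] with ω hω hωs
  funext u
  exact congrArg₂ (· / ·) (hsum ω hω (hI u) u.1.2) hωs

theorem indepFun_div_Iic_Ici (hγ : IsStandardGammaProcess m γ P) (hm : 0 < m) (s : ℝ≥0) :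
    IndepFun (fun ω (u : Set.Iic s) ↦ γ u ω / γ s ω) (fun ω (v : Set.Ici s) ↦ γ v ω) P := by
  have hγm := hγ.measurable
  have hpast : IndepFun (fun ω (u : Set.Iic s) ↦ γ u ω)
      (fun ω (v : Set.Ici s) ↦ γ v ω - γ s ω) P := by
    refine (indepFun_sub_bot_sub_of_hasIndepIncrements hγ.indepIncrements hγm s).congr ?_ .rfl
    filter_upwards [hγ.zero] with ω hω
    simp [hω]
  have hfuture : IndepFun (fun ω (v : Set.Ici s) ↦ γ v ω - γ s ω)
      (fun ω ↦ ((fun u : Set.Iic s ↦ γ u ω / γ s ω), γ s ω)) P :=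
    hpast.symm.comp (φ := id)
      (ψ := fun x : Set.Iic s → ℝ ↦
        (fun u ↦ x u / x ⟨s, Set.self_mem_Iic⟩, x ⟨s, Set.self_mem_Iic⟩))
      measurable_id (by fun_prop)
  have hall := indepFun_prodMk_of_indepFun_prodMk (by fun_prop) (by fun_prop) (hγm s)
    (hγ.indepFun_div_self hm s) hfuture
  simpa [Function.comp_def] using hall.comp (φ := id)
    (ψ := fun (x : (Set.Ici s → ℝ) × ℝ) v ↦ x.1 v + x.2)
    measurable_id (by fun_prop)

end IsStandardGammaProcess

namespace IsStandardGammaBridge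

variable {Ω : Type*} {mΩ : MeasurableSpace Ω} {P : Measure Ω} {m : ℝ} {T : ℝ≥0}
  {Y : Set.Icc (0 : ℝ≥0) T → Ω → ℝ}

theorem ae_mul_div_cancel (hY : IsStandardGammaBridge m T Y P) {u s : Set.Icc (0 : ℝ≥0) T}
    (hus : u ≤ s) : ∀ᵐ ω ∂P, Y s ω * (Y u ω / Y s ω) = Y u ω := by
  obtain ⟨Ω', _, P', γ, _, hγ, hYγ⟩ := hY.law
  refine hYγ.symm.ae_snd (p := fun y ↦ y s * (y u / y s) = y u)
    (measurableSet_eq_fun (by fun_prop) (by fun_prop)) ?_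
  filter_upwards [hγ.ae_mul_div_cancel hus] with ω hu
  rcases eq_or_ne (γ T ω) 0 with hT | hT
  · simp [hT]
  · rw [div_div_div_cancel_right₀ hT, div_mul_eq_mul_div, hu]

variable [IsFiniteMeasure P]

theorem indepFun_div (hY : IsStandardGammaBridge m T Y P) (hm : 0 < m) (hT : 0 < T)
    {s t : Set.Icc (0 : ℝ≥0) T} (hst : s ≤ t) :
    IndepFun (fun ω (u : Set.Iic s) ↦ Y u ω / Y s ω) (fun ω ↦ (Y s ω, Y t ω)) P := by
  obtain ⟨Ω', _, P', γ, _, hγ, hYγ⟩ := hY.law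
  have hγind : IndepFun (fun ω (u : Set.Iic s) ↦ γ u ω / γ s ω)
      (fun ω ↦ (γ s ω / γ T ω, γ t ω / γ T ω)) P' :=
    (hγ.indepFun_div_Iic_Ici hm s).comp
      (φ := fun (x : Set.Iic (s : ℝ≥0) → ℝ) (u : Set.Iic s) ↦ x ⟨u, u.2⟩)
      (ψ := fun x : Set.Ici (s : ℝ≥0) → ℝ ↦
        (x ⟨s, Set.self_mem_Ici⟩ / x ⟨T, s.2.2⟩, x ⟨t, hst⟩ / x ⟨T, s.2.2⟩))
      (by fun_prop) (by fun_prop)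
  have hratio : (fun ω (u : Set.Iic s) ↦ γ u ω / γ s ω) =ᵐ[P']
      fun ω u ↦ γ u ω / γ T ω / (γ s ω / γ T ω) := by
    filter_upwards [hγ.ae_pos hT] with ω hω
    simp only [div_div_div_cancel_right₀ hω.ne']
  exact indepFun_of_identDistrib_pair (hγind.congr hratio .rfl) (hYγ.symm.comp
    (u := fun y : Set.Icc (0 : ℝ≥0) T → ℝ ↦ (fun u : Set.Iic s ↦ y u / y s, (y s, y t)))
    (by fun_prop))

end IsStandardGammaBridge

theorem proposition4_general {Ω : Type*} [MeasurableSpace Ω] (P : Measure Ω)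
    [IsProbabilityMeasure P] (m : ℝ) (hm : 0 < m) (T : ℝ≥0) (hT : 0 < T)
    (X : Ω → ℝ) (hX : Measurable X)
    (Y : Set.Icc (0 : ℝ≥0) T → Ω → ℝ) (hY : IsStandardGammaBridge m T Y P)
    (hXY : IndepFun X (fun ω t ↦ Y t ω) P)
    (ξ : Set.Icc (0 : ℝ≥0) T → Ω → ℝ) (hξm : ∀ t, Measurable (ξ t))
    (hξ : ∀ t, ξ t =ᵐ[P] fun ω ↦ X ω * Y t ω) :
    HasMarkovProperty ξ (Filtration.natural ξ (fun t ↦ (hξm t).stronglyMeasurable)) P := by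
  have hYm := hY.measurable
  refine hasMarkovProperty_natural_of_indepFun hξm (R := fun s u ω ↦ Y u ω / Y s ω)
    (fun s u ↦ by fun_prop) (fun s u ↦ ?_) fun s t hst ↦ ?_
  · filter_upwards [hξ s, hξ u, hY.ae_mul_div_cancel u.2] with ω hs hu hratio
    rw [hs, hu, mul_assoc, hratio]
  · have hXR : IndepFun X (fun ω ↦ (fun u : Set.Iic s ↦ Y u ω / Y s ω, (Y s ω, Y t ω))) P :=
      hXY.comp (φ := id)
        (ψ := fun y : Set.Icc (0 : ℝ≥0) T → ℝ ↦ (fun u : Set.Iic s ↦ y u / y s, (y s, y t)))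
        measurable_id (by fun_prop)
    have hR : IndepFun (fun ω (u : Set.Iic s) ↦ Y u ω / Y s ω)
        (fun ω ↦ (X ω * Y s ω, X ω * Y t ω)) P :=
      (indepFun_prodMk_of_indepFun_prodMk (by fun_prop) hX (by fun_prop)
        (hY.indepFun_div hm hT hst) hXR).comp (φ := id)
        (ψ := fun p : ℝ × ℝ × ℝ ↦ (p.1 * p.2.1, p.1 * p.2.2)) measurable_id (by fun_prop)
    refine hR.congr .rfl ?_
    filter_upwards [hξ s, hξ t] with ω hs ht
    rw [hs, ht]

theorem proposition4 {Ω : Type*} [MeasurableSpace Ω] (P : Measure Ω) [IsProbabilityMeasure P]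
    (m : ℝ) (hm : 0 < m) (T : ℝ≥0) (hT : 0 < T)
    (X : Ω → ℝ) (hX : Measurable X) (hXpos : ∀ᵐ ω ∂P, 0 < X ω)
    (Y : Set.Icc (0 : ℝ≥0) T → Ω → ℝ) (hY : IsStandardGammaBridge m T Y P)
    (hXY : IndepFun X (fun ω t ↦ Y t ω) P)
    (ξ : Set.Icc (0 : ℝ≥0) T → Ω → ℝ) (hξm : ∀ t, Measurable (ξ t))
    (hξ : ∀ t, ξ t =ᵐ[P] fun ω ↦ X ω * Y t ω) :
    HasMarkovProperty ξ (Filtration.natural ξ (fun t ↦ (hξm t).stronglyMeasurable)) P :=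
  proposition4_general P m hm T hT X hX Y hY hXY ξ hξm hξ
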